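/- For a complex matrix $A$ let $\|A\|_{\mathrm{Tr}}=\operatorname{Tr}\sqrt{A^\dagger A}$ be the trace norm, and let $\operatorname{Vec}(A)$ be the column vector obtained by stacking the columns of $A$. For a matrix $Z$ acting on $\mathbb{C}^{d_A}\otimes\mathbb{C}^{d_B}$, with blocks $Z_{i,j}\in\mathbb{C}^{d_B\times d_B}$ $(1\le i,j\le d_A)$, the realigned matrix $\mathcal{R}(Z)\in\mathbb{C}^{d_A^2\times d_B^2}$ is the matrix with rows $\operatorname{Vec}(Z_{1,1})^T,\dots,\operatorname{Vec}(Z_{d_A,1})^T,\dots,\operatorname{Vec}(Z_{1,d_A})^T,\dots,\operatorname{Vec}(Z_{d_A,d_A})^T$, in this order. For real vectors $\mu\in\mathbb{R}^n$ and $\nu\in\mathbb{R}^m$ (with Euclidean norms $|\mu|,|\nu|$) and a state $\rho$ on $\mathbb{C}^{d_A}\otimes\mathbb{C}^{d_B}$ with reduced states $\rho_A=\operatorname{Tr}_B\rho$ and $\rho_B=\operatorname{Tr}_A\rho$, put $$\mathcal{Q}_{\mu,\nu}(\rho)=\begin{pmatrix}\mu\nu^T & \mu\operatorname{Vec}(\rho_B)^T\\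 \operatorname{Vec}(\rho_A)\nu^T & \mathcal{R}(\rho)\end{pmatrix}.$$ For a state (density matrix) $\rho$ on $\mathbb{C}^d\otimes\mathbb{C}^d\otimes\mathbb{C}^d$ and $\{i,j,k\}=\{1,2,3\}$ let $\mathcal{Q}_{i|jk}(\rho)$ be the matrix $\mathcal{Q}_{\mu,\nu}(\rho)$ formed under the bipartition $i|jk$ (so that $A$ is the $i$-th subsystem and $B$ consists of the two others), and let $$\mathscr{Q}(\rho)=\tfrac13\left(\|\mathcal{Q}_{1|23}(\rho)\|_{\mathrm{Tr}}+\|\mathcal{Q}_{2|13}(\rho)\|_{\mathrm{Tr}}+\|\mathcal{Q}_{3|12}(\rho)\|_{\mathrm{Tr}}\right).$$ The state $\rho$ is called biseparable if it is a finite convex combination of projectors $|\varphi\rangle\langle\varphi|$ onto unit vectors, each of which is a product vector under at least one of the bipartitions $1|23$, $2|13$, $3|12$; otherwise $\rho$ is called genuinely tripartite entangled. **Theorem.** Let $\mu\in\mathbb{R}^n$, $\nu\in\mathbb{R}^m$, and let $\rho$ be a state on $\mathbb{C}^d\otimes\mathbb{C}^d\otimes\mathbb{C}^d$. If $\rho$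 is biseparable, then $$\mathscr{Q}(\rho)\le\sqrt{(|\mu|^2+1)(|\nu|^2+1)}+\frac{2(d-1)}{3}.$$ Consequently, if $\mathscr{Q}(\rho)>\sqrt{(|\mu|^2+1)(|\nu|^2+1)}+\frac{2(d-1)}{3}$, then $\rho$ is genuinely tripartite entangled. -/

import Mathlib

noncomputable section

namespace Tripartite

open scoped Matrix MatrixOrder ComplexOrder

/-- The trace norm `‖A‖_Tr = Tr √(A† A)` of a complex (possibly rectangular) matrix. The trace is
that of a positive semidefinite matrix, hence real. -/
def traceNorm {m n : Type*} [Fintype m] [Fintype n] [DecidableEq n] (A : Matrix m n ℂ) : ℝ :=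
  (CFC.sqrt (Aᴴ * A)).trace.re

/-- A state (density matrix): positive semidefinite with trace one. -/
def IsState {ι : Type*} [Fintype ι] (ρ : Matrix ι ι ℂ) : Prop :=
  ρ.PosSemidef ∧ ρ.trace = 1

/-- The rank-one operator `|φ⟩⟨φ|`. -/
def ketBra {ι : Type*} (φ : EuclideanSpace ℂ ι) : Matrix ι ι ℂ :=
  Matrix.of fun x y => φ x * star (φ y)

/-! ### Bipartite matrices -/

/-- The partial trace `Tr_A` over the first subsystem; `ρ_B = Tr_A ρ`. -/
def traceFst {α β : Type*} [Fintype α] (ρ : Matrix (α × β) (α × β) ℂ) : Matrix β β ℂ :=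
  Matrix.of fun k l => ∑ i, ρ (i, k) (i, l)

/-- The partial trace `Tr_B` over the second subsystem; `ρ_A = Tr_B ρ`. -/
def traceSnd {α β : Type*} [Fintype β] (ρ : Matrix (α × β) (α × β) ℂ) : Matrix α α ℂ :=
  Matrix.of fun i j => ∑ k, ρ (i, k) (j, k)

/-- The block `Z_{i,j}` of a bipartite matrix `Z`. -/
def block {α β : Type*} (Z : Matrix (α × β) (α × β) ℂ) (i j : α) : Matrix β β ℂ :=
  Matrix.of fun k l => Z (i, k) (j, l)

/-- The realigned matrix `R(Z)`: its rows are the `Vec(Z_{i,j})ᵀ`, ordered column by column. The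
index `p = (j, i)` of a row is the one which `Matrix.vec` (stacking of columns) gives to the
entry in row `i` and column `j`. -/
def realign {α β : Type*} (Z : Matrix (α × β) (α × β) ℂ) : Matrix (α × α) (β × β) ℂ :=
  Matrix.of fun p => (block Z p.2 p.1).vec

/-- The block matrix
`Q_{μ,ν}(ρ) = [[μ νᵀ, μ Vec(ρ_B)ᵀ], [Vec(ρ_A) νᵀ, R(ρ)]]`. -/
def Q {α β : Type*} [Fintype α] [Fintype β] {n m : ℕ}
    (μ : EuclideanSpace ℝ (Fin n)) (ν : EuclideanSpace ℝ (Fin m))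
    (ρ : Matrix (α × β) (α × β) ℂ) : Matrix (Fin n ⊕ α × α) (Fin m ⊕ β × β) ℂ :=
  Matrix.fromBlocks
    (Matrix.vecMulVec (fun a => (μ a : ℂ)) (fun b => (ν b : ℂ)))
    (Matrix.vecMulVec (fun a => (μ a : ℂ)) (traceFst ρ).vec)
    (Matrix.vecMulVec (traceSnd ρ).vec (fun b => (ν b : ℂ)))
    (realign ρ)

/-! ### Tripartite matrices

A vector or matrix on the tripartite system `1 2 3` is indexed by `α × β × γ = α × (β × γ)`. -/

section

variable {α β γ : Type*}

/-- A tripartite matrix, viewed as a bipartite one under the bipartition `1|23`. -/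
def cut1 (ρ : Matrix (α × β × γ) (α × β × γ) ℂ) : Matrix (α × (β × γ)) (α × (β × γ)) ℂ := ρ

/-- A tripartite matrix, viewed as a bipartite one under the bipartition `2|13`. -/
def cut2 (ρ : Matrix (α × β × γ) (α × β × γ) ℂ) : Matrix (β × (α × γ)) (β × (α × γ)) ℂ :=
  Matrix.of fun x y => ρ (x.2.1, x.1, x.2.2) (y.2.1, y.1, y.2.2)

/-- A tripartite matrix, viewed as a bipartite one under the bipartition `3|12`. -/
def cut3 (ρ : Matrix (α × β × γ) (α × β × γ) ℂ) : Matrix (γ × (α × β)) (γ × (α × β)) ℂ :=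
  Matrix.of fun x y => ρ (x.2.1, x.2.2, x.1) (y.2.1, y.2.2, y.1)

/-- `φ` is a product vector `|φ_1⟩ ⊗ |φ_23⟩` under the bipartition `1|23`. -/
def IsProduct1 (φ : EuclideanSpace ℂ (α × β × γ)) : Prop :=
  ∃ (χ : EuclideanSpace ℂ α) (ψ : EuclideanSpace ℂ (β × γ)),
    ∀ i j k, φ (i, j, k) = χ i * ψ (j, k)

/-- `φ` is a product vector under the bipartition `2|13`. -/
def IsProduct2 (φ : EuclideanSpace ℂ (α × β × γ)) : Prop :=
  ∃ (χ : EuclideanSpace ℂ β) (ψ : EuclideanSpace ℂ (α × γ)),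
    ∀ i j k, φ (i, j, k) = χ j * ψ (i, k)

/-- `φ` is a product vector under the bipartition `3|12`. -/
def IsProduct3 (φ : EuclideanSpace ℂ (α × β × γ)) : Prop :=
  ∃ (χ : EuclideanSpace ℂ γ) (ψ : EuclideanSpace ℂ (α × β)),
    ∀ i j k, φ (i, j, k) = χ k * ψ (i, j)

variable [Fintype α] [Fintype β] [Fintype γ]

/-- `ρ` is biseparable: it is a convex combination of pure states (projectors onto unit vectors)
each of which is a product under one of the bipartitions `1|23`, `2|13`, `3|12`. -/
def IsBiseparable (ρ : Matrix (α × β × γ) (α × β × γ) ℂ) : Prop :=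
  ∃ (a b c : ℕ) (p : Fin a → ℝ) (q : Fin b → ℝ) (r : Fin c → ℝ)
    (φ : Fin a → EuclideanSpace ℂ (α × β × γ))
    (ψ : Fin b → EuclideanSpace ℂ (α × β × γ))
    (ω : Fin c → EuclideanSpace ℂ (α × β × γ)),
    (∀ i, 0 ≤ p i ∧ ‖φ i‖ = 1 ∧ IsProduct1 (φ i)) ∧
    (∀ j, 0 ≤ q j ∧ ‖ψ j‖ = 1 ∧ IsProduct2 (ψ j)) ∧
    (∀ k, 0 ≤ r k ∧ ‖ω k‖ = 1 ∧ IsProduct3 (ω k)) ∧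
    ∑ i, p i + ∑ j, q j + ∑ k, r k = 1 ∧
    ρ = ∑ i, (p i : ℂ) • ketBra (φ i) + ∑ j, (q j : ℂ) • ketBra (ψ j)
      + ∑ k, (r k : ℂ) • ketBra (ω k)

/-- A state is genuinely tripartite entangled if it is not biseparable. -/
def IsGenuinelyEntangled (ρ : Matrix (α × β × γ) (α × β × γ) ℂ) : Prop :=
  IsState ρ ∧ ¬ IsBiseparable ρ

variable [DecidableEq α] [DecidableEq β] [DecidableEq γ]

/-- The average of the trace norms of `Q_{μ,ν}` under the three bipartitions. -/
def avgQ {n m : ℕ} (μ : EuclideanSpace ℝ (Fin n)) (ν : EuclideanSpace ℝ (Fin m))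
    (ρ : Matrix (α × β × γ) (α × β × γ) ℂ) : ℝ :=
  (1 / 3 : ℝ) * (traceNorm (Q μ ν (cut1 ρ)) + traceNorm (Q μ ν (cut2 ρ))
    + traceNorm (Q μ ν (cut3 ρ)))

end

end Tripartite

end

open scoped Matrix MatrixOrder ComplexOrder

/-! ### Singular values and trace-norm duality. -/

namespace Tripartite

/-! The trace norm is dual to the operator norm: `exists_dual_functional` gives, for a matrix `A`, a
real-linear functional that equals the trace norm at `A` and is at most `‖x‖ * ‖y‖` on each rank-one
matrix `x yᵀ`. Applied to `Q` of a mixture, it replaces the triangle inequality and reduces the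
bound to pure states.

For a product vector `Q` has rank one, and its two factors give the square root
(`functional_Q_product_le`). For a general unit vector, with Schmidt coefficients `s i = ‖w i‖`, `Q`
is a mixture with weights `s i ^ 2` of such rank-one matrices, plus cross terms of norm `s i * s j`,
`i ≠ j`, that live in the realigned block alone. These cost at most `(∑ s i) ^ 2 - 1 ≤ d - 1` by
Cauchy–Schwarz (`functional_Q_le`).

Each component of a biseparable state is a product in at least one cut, so the excess `d - 1` is
charged in at most two of the three cuts, and averaging gives `2 (d - 1) / 3`. -/

lemma sum_basis_apply_mul_star {α : Type*} [Fintype α] [DecidableEq α]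
    (v : OrthonormalBasis α ℂ (EuclideanSpace ℂ α)) (a b : α) :
    ∑ i, v i a * star (v i b) = if a = b then 1 else 0 := by
  have h := congrArg (fun x : EuclideanSpace ℂ α => x a)
    (v.sum_repr' (EuclideanSpace.single b (1 : ℂ)))
  simp only [EuclideanSpace.inner_single_right, WithLp.ofLp_sum, Finset.sum_apply,
    PiLp.smul_apply, smul_eq_mul, one_mul, PiLp.single_apply] at h
  rw [← h]
  exact Finset.sum_congr rfl fun i _ => mul_comm _ _

lemma trace_sqrt {n : Type*} [Fintype n] [DecidableEq n] {A : Matrix n n ℂ} (hA : A.PosSemidef) :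
    (CFC.sqrt A).trace = ∑ i, (Real.sqrt (hA.1.eigenvalues i) : ℂ) := by
  have h0 : 0 ≤ A := hA.nonneg
  rw [CFC.sqrt_eq_cfc, cfc_nnreal_eq_real _ A, hA.1.cfc_eq, Matrix.IsHermitian.cfc,
    Unitary.conjStarAlgAut_apply, Matrix.trace_mul_cycle]
  simp [Matrix.trace, hA.eigenvalues_nonneg]

/-- A singular value decomposition: `A = ∑ i, w i (v i)†` with `v` an orthonormal basis and the
`w i` pairwise orthogonal; the singular values are the norms of the `w i`. -/
theorem exists_singular_decomposition {m n : Type*} [Fintype m] [Fintype n] [DecidableEq n]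
    (A : Matrix m n ℂ) :
    ∃ (v : OrthonormalBasis n ℂ (EuclideanSpace ℂ n)) (w : n → EuclideanSpace ℂ m),
      (∀ i, (w i).ofLp = A *ᵥ (v i).ofLp) ∧
      (∀ i j, i ≠ j → inner ℂ (w i) (w j) = 0) ∧
      (∀ a b, A a b = ∑ i, w i a * star (v i b)) ∧
      traceNorm A = ∑ i, ‖w i‖ := by
  have hA : (Aᴴ * A).PosSemidef := Matrix.posSemidef_conjTranspose_mul_self A
  set v := hA.1.eigenvectorBasis with hv
  -- The Gram matrix of the images `A v i` is diagonal, with the eigenvalues of `A† A` as entries: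
  -- this gives both their orthogonality and their norms.
  have hin : ∀ i j, inner ℂ (WithLp.toLp 2 (A *ᵥ (v i).ofLp))
      (WithLp.toLp 2 (A *ᵥ (v j).ofLp)) = (hA.1.eigenvalues j : ℂ) * inner ℂ (v i) (v j) := by
    intro i j
    rw [EuclideanSpace.inner_eq_star_dotProduct, EuclideanSpace.inner_eq_star_dotProduct]
    simp only
    rw [Matrix.star_mulVec, dotProduct_comm, ← Matrix.dotProduct_mulVec, Matrix.mulVec_mulVec,
      hv, hA.1.mulVec_eigenvectorBasis j, dotProduct_smul, dotProduct_comm]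
    simp
  refine ⟨v, fun i => WithLp.toLp 2 (A *ᵥ (v i).ofLp), fun i => rfl, ?_, ?_, ?_⟩
  · intro i j hij
    rw [hin, v.orthonormal.2 hij, mul_zero]
  · intro a b
    simp only [Matrix.mulVec, dotProduct, Finset.sum_mul]
    rw [Finset.sum_comm]
    simp only [mul_assoc, ← Finset.mul_sum, sum_basis_apply_mul_star]
    simp
  · rw [traceNorm, trace_sqrt hA, ← Complex.ofReal_sum, Complex.ofReal_re]
    refine Finset.sum_congr rfl fun i _ => ?_
    rw [@norm_eq_sqrt_re_inner ℂ, hin]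
    simp [v.orthonormal.1]

/-- Bessel's inequality for the normalization of a pairwise orthogonal family, some members of
which may vanish. -/
lemma sum_norm_inner_normalize_sq_le {ι E : Type*} [Fintype ι] [NormedAddCommGroup E]
    [InnerProductSpace ℂ E] (w : ι → E) (hw : ∀ i j, i ≠ j → inner ℂ (w i) (w j) = 0) (x : E) :
    ∑ i, ‖inner ℂ (((‖w i‖⁻¹ : ℝ) : ℂ) • w i) x‖ ^ 2 ≤ ‖x‖ ^ 2 := by
  classical
  have ho : Orthonormal ℂ fun i : {i // w i ≠ 0} => ((‖w i‖⁻¹ : ℝ) : ℂ) • w i := by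
    refine ⟨fun i => ?_, fun i j hij => ?_⟩
    · rw [norm_smul, Complex.norm_real, norm_inv, norm_norm,
        inv_mul_cancel₀ (norm_ne_zero_iff.2 i.2)]
    · simp only [inner_smul_left, inner_smul_right]
      rw [hw _ _ (fun h => hij (Subtype.ext h)), mul_zero,
        mul_zero]
  refine le_trans (le_of_eq ?_) (ho.sum_inner_products_le x (s := Finset.univ))
  rw [← Finset.sum_subtype (Finset.univ.filter (w · ≠ 0)) (by simp)
    (fun i => ‖inner ℂ (((‖w i‖⁻¹ : ℝ) : ℂ) • w i) x‖ ^ 2)]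
  refine (Finset.sum_subset (Finset.filter_subset _ _) fun i _ hi => ?_).symm
  have : w i = 0 := by simpa using hi
  simp [this]

/-- A functional which attains the trace norm at `A` and is dominated by it on rank-one
matrices. -/
theorem exists_dual_functional {m n : Type*} [Fintype m] [Fintype n] [DecidableEq n]
    (A : Matrix m n ℂ) :
    ∃ L : Matrix m n ℂ →ₗ[ℝ] ℝ, L A = traceNorm A ∧
      ∀ x y, L (Matrix.vecMulVec x y) ≤ ‖WithLp.toLp 2 x‖ * ‖WithLp.toLp 2 y‖ := by
  obtain ⟨v, w, hwv, hw, -, hA⟩ := exists_singular_decomposition A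
  -- `L B` is `Re Tr (U† B)` for the polar factor `U = ∑ u i (v i)†` of `A`. Since `0⁻¹ = 0`, `u i`
  -- vanishes where `w i` does.
  let u : n → EuclideanSpace ℂ m := fun i => ((‖w i‖⁻¹ : ℝ) : ℂ) • w i
  let L : Matrix m n ℂ →ₗ[ℝ] ℝ :=
    { toFun := fun B => ∑ i, (inner ℂ (u i) (WithLp.toLp 2 (B *ᵥ (v i).ofLp))).re
      map_add' := fun B C => by
        simp [Matrix.add_mulVec, WithLp.toLp_add, Finset.sum_add_distrib]
      map_smul' := fun r B => by
        simp only [Matrix.smul_mulVec, WithLp.toLp_smul, RingHom.id_apply, smul_eq_mul,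
          Finset.mul_sum]
        refine Finset.sum_congr rfl fun i _ => ?_
        rw [inner_smul_right_eq_smul]
        simp }
  refine ⟨L, ?_, fun x y => ?_⟩
  · rw [hA]
    refine Finset.sum_congr rfl fun i _ => ?_
    rw [← hwv, WithLp.toLp_ofLp, inner_smul_left, inner_self_eq_norm_sq_to_K]
    by_cases h : ‖w i‖ = 0
    · simp [h]
    · have : ‖w i‖⁻¹ * ‖w i‖ ^ 2 = ‖w i‖ := by field_simp
      simp only [Complex.conj_ofReal, Complex.coe_algebraMap]
      exact_mod_cast this
  · have hterm : ∀ i, inner ℂ (u i) (WithLp.toLp 2 (Matrix.vecMulVec x y *ᵥ (v i).ofLp)) =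
        inner ℂ (WithLp.toLp 2 (star y)) (v i) * inner ℂ (u i) (WithLp.toLp 2 x) := by
      intro i
      rw [Matrix.vecMulVec_mulVec]
      simp [EuclideanSpace.inner_eq_star_dotProduct, dotProduct_comm y, mul_comm]
    have hy : ‖WithLp.toLp 2 (star y)‖ = ‖WithLp.toLp 2 y‖ := by
      simp [EuclideanSpace.norm_eq]
    calc L (Matrix.vecMulVec x y)
        = ∑ i, (inner ℂ (WithLp.toLp 2 (star y)) (v i) *
            inner ℂ (u i) (WithLp.toLp 2 x)).re :=
          Finset.sum_congr rfl fun i _ => by rw [hterm]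
      _ ≤ ∑ i, ‖inner ℂ (u i) (WithLp.toLp 2 x)‖ * ‖inner ℂ (v i) (WithLp.toLp 2 (star y))‖ := by
          refine Finset.sum_le_sum fun i _ => (Complex.re_le_norm _).trans ?_
          rw [norm_mul, norm_inner_symm, mul_comm]
      _ ≤ √(∑ i, ‖inner ℂ (u i) (WithLp.toLp 2 x)‖ ^ 2) *
            √(∑ i, ‖inner ℂ (v i) (WithLp.toLp 2 (star y))‖ ^ 2) :=
          Real.sum_mul_le_sqrt_mul_sqrt _ _ _
      _ ≤ ‖WithLp.toLp 2 x‖ * ‖WithLp.toLp 2 y‖ := by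
          rw [← hy]
          refine mul_le_mul ?_ ?_ (Real.sqrt_nonneg _) (norm_nonneg _)
          · exact (Real.sqrt_le_left (norm_nonneg _)).2 (sum_norm_inner_normalize_sq_le w hw _)
          · exact (Real.sqrt_le_left (norm_nonneg _)).2 (v.orthonormal.sum_inner_products_le _)

end Tripartite

/-! ### `Q` of pure states and of mixtures across one bipartition. -/

namespace Tripartite

section Bipartite

variable {α β : Type*} [Fintype α] [Fintype β] {n m : ℕ}

/-- Three blocks are linear in the state, but `μ νᵀ` is constant, so `Q` is only affine and the
weights have to sum to one. -/
lemma Q_sum_smul {ι : Type*} [Fintype ι] (μ : EuclideanSpace ℝ (Fin n))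
    (ν : EuclideanSpace ℝ (Fin m)) (p : ι → ℝ) (hp : ∑ i, p i = 1)
    (σ : ι → Matrix (α × β) (α × β) ℂ) :
    Q μ ν (∑ i, (p i : ℂ) • σ i) = ∑ i, p i • Q μ ν (σ i) := by
  have hp' : ∑ i, (p i : ℂ) = 1 := by exact_mod_cast hp
  ext x y
  rcases x with x | x <;> rcases y with y | y
  · simp [Q, Matrix.sum_apply, Matrix.vecMulVec_apply, ← Finset.sum_mul, hp']
  · simp only [Q, Matrix.sum_apply, Matrix.smul_apply, Matrix.fromBlocks_apply₁₂,
      Matrix.vecMulVec_apply, Matrix.vec, traceFst, Matrix.of_apply, Finset.mul_sum,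
      Complex.real_smul, smul_eq_mul]
    rw [Finset.sum_comm]
    exact Finset.sum_congr rfl fun _ _ => Finset.sum_congr rfl fun _ _ => by ring
  · simp only [Q, Matrix.sum_apply, Matrix.smul_apply, Matrix.fromBlocks_apply₂₁,
      Matrix.vecMulVec_apply, Matrix.vec, traceSnd, Matrix.of_apply, Finset.mul_sum,
      Finset.sum_mul, Complex.real_smul, smul_eq_mul]
    rw [Finset.sum_comm]
    exact Finset.sum_congr rfl fun _ _ => Finset.sum_congr rfl fun _ _ => by ring
  · simp only [Q, Matrix.sum_apply, Matrix.smul_apply, Matrix.fromBlocks_apply₂₂, Matrix.vec,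
      realign, block, Matrix.of_apply, Complex.real_smul, smul_eq_mul]

lemma norm_toLp_kron_sq (x y : EuclideanSpace ℂ α) :
    ‖WithLp.toLp 2 (fun p : α × α => x p.1 * y p.2)‖ ^ 2 = (‖x‖ * ‖y‖) ^ 2 := by
  simp [EuclideanSpace.norm_sq_eq, mul_pow, Fintype.sum_prod_type, Finset.sum_mul_sum]

lemma norm_toLp_sumElim_sq {κ : Type*} [Fintype κ] (μ : EuclideanSpace ℝ (Fin n)) (x : κ → ℂ) :
    ‖WithLp.toLp 2 (Sum.elim (fun a => (μ a : ℂ)) x)‖ ^ 2 = ‖μ‖ ^ 2 + ‖WithLp.toLp 2 x‖ ^ 2 := by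
  simp [EuclideanSpace.norm_sq_eq]

lemma norm_star_coord (x : EuclideanSpace ℂ α) : ‖WithLp.toLp 2 (star x.ofLp)‖ = ‖x‖ := by
  simp [EuclideanSpace.norm_eq]

/-- The vector `(μ, x ⊗ y)`; such vectors are the factors of the rank-one terms of `Q_{μ,ν}` of a pure state. -/
def extVec (μ : EuclideanSpace ℝ (Fin n)) (x y : EuclideanSpace ℂ α) : Fin n ⊕ α × α → ℂ :=
  Sum.elim (fun a => (μ a : ℂ)) fun p => x p.1 * y p.2

lemma norm_extVec_sq (μ : EuclideanSpace ℝ (Fin n)) (x y : EuclideanSpace ℂ α) :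
    ‖WithLp.toLp 2 (extVec μ x y)‖ ^ 2 = ‖μ‖ ^ 2 + (‖x‖ * ‖y‖) ^ 2 := by
  rw [extVec, norm_toLp_sumElim_sq, norm_toLp_kron_sq]

lemma norm_extVec_mul_le (μ : EuclideanSpace ℝ (Fin n)) (ν : EuclideanSpace ℝ (Fin m))
    {x y : EuclideanSpace ℂ α} {z w : EuclideanSpace ℂ β}
    (hx : ‖x‖ * ‖y‖ ≤ 1) (hz : ‖z‖ * ‖w‖ ≤ 1) :
    ‖WithLp.toLp 2 (extVec μ x y)‖ * ‖WithLp.toLp 2 (extVec ν z w)‖ ≤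
      √((‖μ‖ ^ 2 + 1) * (‖ν‖ ^ 2 + 1)) := by
  refine Real.le_sqrt_of_sq_le ?_
  rw [mul_pow, norm_extVec_sq, norm_extVec_sq]
  have h1 : (‖x‖ * ‖y‖) ^ 2 ≤ 1 := pow_le_one₀ (by positivity) hx
  have h2 : (‖z‖ * ‖w‖) ^ 2 ≤ 1 := pow_le_one₀ (by positivity) hz
  gcongr

/-- The bound of `Q_{μ,ν}` of a product vector. -/
lemma functional_Q_product_le (μ : EuclideanSpace ℝ (Fin n)) (ν : EuclideanSpace ℝ (Fin m))
    (L : Matrix (Fin n ⊕ α × α) (Fin m ⊕ β × β) ℂ →ₗ[ℝ] ℝ)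
    (hL : ∀ x y, L (Matrix.vecMulVec x y) ≤ ‖WithLp.toLp 2 x‖ * ‖WithLp.toLp 2 y‖)
    {φ : EuclideanSpace ℂ (α × β)} (hφ : ‖φ‖ = 1)
    {χ : EuclideanSpace ℂ α} {ψ : EuclideanSpace ℂ β} (h : ∀ i j, φ (i, j) = χ i * ψ j) :
    L (Q μ ν (ketBra φ)) ≤ √((‖μ‖ ^ 2 + 1) * (‖ν‖ ^ 2 + 1)) := by
  have hn : ‖χ‖ ^ 2 * ‖ψ‖ ^ 2 = 1 := by
    rw [← one_pow 2, ← hφ]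
    simp [EuclideanSpace.norm_sq_eq, h, mul_pow, Fintype.sum_prod_type, Finset.sum_mul_sum]
  have hχ : ∑ i, χ i * star (χ i) = ((‖χ‖ ^ 2 : ℝ) : ℂ) := by
    simp [EuclideanSpace.norm_sq_eq, Complex.mul_conj']
  have hψ : ∑ i, ψ i * star (ψ i) = ((‖ψ‖ ^ 2 : ℝ) : ℂ) := by
    simp [EuclideanSpace.norm_sq_eq, Complex.mul_conj']
  have hn' : ((‖χ‖ ^ 2 : ℝ) : ℂ) * ((‖ψ‖ ^ 2 : ℝ) : ℂ) = 1 := by exact_mod_cast hn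
  -- The factors `χ` and `ψ` need not be unit vectors; only `‖χ‖ * ‖ψ‖ = 1` holds. The reduced
  -- states therefore carry the weights `‖ψ‖ ^ 2` and `‖χ‖ ^ 2`, whose product is one in the
  -- realigned block.
  have hQ : Q μ ν (ketBra φ) = Matrix.vecMulVec
      (extVec μ (((‖ψ‖ ^ 2 : ℝ) : ℂ) • WithLp.toLp 2 (star χ.ofLp)) χ)
      (extVec ν (((‖χ‖ ^ 2 : ℝ) : ℂ) • WithLp.toLp 2 (star ψ.ofLp)) ψ) := by
    ext x y
    rcases x with x | x <;> rcases y with y | y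
    · simp [Q, extVec, Matrix.vecMulVec_apply]
    · simp only [Q, extVec, Matrix.fromBlocks_apply₁₂, Matrix.vecMulVec_apply, Matrix.vec,
        traceFst, ketBra, Matrix.of_apply, h, Sum.elim_inl, Sum.elim_inr, PiLp.smul_apply,
        smul_eq_mul, ← hχ, Finset.sum_mul, Pi.star_apply, star_mul']
      exact congrArg _ (Finset.sum_congr rfl fun _ _ => by ring)
    · simp only [Q, extVec, Matrix.fromBlocks_apply₂₁, Matrix.vecMulVec_apply, Matrix.vec,
        traceSnd, ketBra, Matrix.of_apply, h, Sum.elim_inl, Sum.elim_inr, PiLp.smul_apply,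
        smul_eq_mul, ← hψ, Finset.sum_mul, Pi.star_apply, star_mul']
      exact Finset.sum_congr rfl fun _ _ => by ring
    · simp only [Q, extVec, Matrix.fromBlocks_apply₂₂, Matrix.vecMulVec_apply, Matrix.vec,
        realign, block, ketBra, Matrix.of_apply, h, Sum.elim_inr, PiLp.smul_apply,
        smul_eq_mul, Pi.star_apply, star_mul']
      linear_combination (-(χ x.2 * ψ y.2 * (star (χ x.1) * star (ψ y.1)))) * hn'
  rw [hQ]
  refine (hL _ _).trans (norm_extVec_mul_le μ ν ?_ ?_)
  · rw [norm_smul, norm_star_coord, Complex.norm_real, Real.norm_of_nonneg (by positivity)]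
    nlinarith [hn]
  · rw [norm_smul, norm_star_coord, Complex.norm_real, Real.norm_of_nonneg (by positivity)]
    nlinarith [hn]

/-- A Schmidt decomposition: `φ = ∑ i, v i ⊗ w i` with unit vectors `v i` and with the reduced
states diagonal in the `v i` and `w i`. -/
theorem exists_schmidt_decomposition [DecidableEq α] (φ : EuclideanSpace ℂ (α × β)) :
    ∃ (v : α → EuclideanSpace ℂ α) (w : α → EuclideanSpace ℂ β),
      (∀ i, ‖v i‖ = 1) ∧
      (∀ a b, φ (a, b) = ∑ i, star (v i a) * w i b) ∧
      (∀ k l, traceFst (ketBra φ) k l = ∑ i, w i k * star (w i l)) ∧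
      (∀ a b, traceSnd (ketBra φ) a b = ∑ i, ((‖w i‖ ^ 2 : ℝ) : ℂ) * (star (v i a) * v i b)) ∧
      ‖φ‖ ^ 2 = ∑ i, ‖w i‖ ^ 2 := by
  -- Taking `α` as the column index makes the `v i` a basis of the `α` system, so the sum has `card
  -- α` terms whatever the size of `β`.
  obtain ⟨v, w, -, hw, h, -⟩ :=
    exists_singular_decomposition (Matrix.of fun (b : β) (a : α) => φ (a, b))
  have h' : ∀ a b, φ (a, b) = ∑ i, star (v i a) * w i b := fun a b => by
    rw [← Matrix.of_apply (fun (b : β) (a : α) => φ (a, b)) b a, h]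
    exact Finset.sum_congr rfl fun i _ => mul_comm _ _
  have hv : ∀ i j, ∑ a, v i a * star (v j a) = if i = j then 1 else 0 := fun i j => by
    have := orthonormal_iff_ite.1 v.orthonormal j i
    rw [EuclideanSpace.inner_eq_star_dotProduct] at this
    simpa [dotProduct, eq_comm] using this
  have hw' : ∀ i j, ∑ b, w i b * star (w j b) = if i = j then ((‖w i‖ ^ 2 : ℝ) : ℂ) else 0 := by
    intro i j
    split_ifs with hij
    · subst hij
      simp [EuclideanSpace.norm_sq_eq, Complex.mul_conj']
    · have := hw j i (Ne.symm hij)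
      rw [EuclideanSpace.inner_eq_star_dotProduct] at this
      simpa [dotProduct] using this
  have hF : ∀ k l, traceFst (ketBra φ) k l = ∑ i, w i k * star (w i l) := by
    intro k l
    calc traceFst (ketBra φ) k l
        = ∑ i, ∑ j, (w i k * star (w j l)) * ∑ a, v j a * star (v i a) := by
          simp only [traceFst, ketBra, Matrix.of_apply, h', star_sum, Finset.sum_mul_sum,
            star_mul', star_star]
          simp only [Finset.mul_sum]
          rw [Finset.sum_comm]
          refine Finset.sum_congr rfl fun i _ => ?_
          rw [Finset.sum_comm]
          exact Finset.sum_congr rfl fun j _ => Finset.sum_congr rfl fun a _ => by ring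
      _ = ∑ i, w i k * star (w i l) := by
          simp only [hv, mul_ite, mul_one, mul_zero, Finset.sum_ite_eq', Finset.mem_univ, if_true]
  have hS : ∀ a b, traceSnd (ketBra φ) a b =
      ∑ i, ((‖w i‖ ^ 2 : ℝ) : ℂ) * (star (v i a) * v i b) := by
    intro a b
    calc traceSnd (ketBra φ) a b
        = ∑ i, ∑ j, (star (v i a) * v j b) * ∑ k, w i k * star (w j k) := by
          simp only [traceSnd, ketBra, Matrix.of_apply, h', star_sum, Finset.sum_mul_sum,
            star_mul', star_star]
          simp only [Finset.mul_sum]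
          rw [Finset.sum_comm]
          refine Finset.sum_congr rfl fun i _ => ?_
          rw [Finset.sum_comm]
          exact Finset.sum_congr rfl fun j _ => Finset.sum_congr rfl fun a _ => by ring
      _ = ∑ i, ((‖w i‖ ^ 2 : ℝ) : ℂ) * (star (v i a) * v i b) := by
          simp only [hw', mul_ite, mul_zero, Finset.sum_ite_eq, Finset.mem_univ, if_true]
          exact Finset.sum_congr rfl fun i _ => mul_comm _ _
  refine ⟨v, w, v.orthonormal.1, h', hF, hS, ?_⟩
  have hc : ((‖φ‖ ^ 2 : ℝ) : ℂ) = ((∑ i, ‖w i‖ ^ 2 : ℝ) : ℂ) := by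
    calc ((‖φ‖ ^ 2 : ℝ) : ℂ) = ∑ k, traceFst (ketBra φ) k k := by
          simp [EuclideanSpace.norm_sq_eq, Complex.mul_conj', Fintype.sum_prod_type, traceFst,
            ketBra]
          exact Finset.sum_comm
      _ = ((∑ i, ‖w i‖ ^ 2 : ℝ) : ℂ) := by
          simp only [hF]
          rw [Finset.sum_comm]
          simp [EuclideanSpace.norm_sq_eq, Complex.mul_conj']
  exact_mod_cast hc

/-- The bound of `Q_{μ,ν}` of an arbitrary unit vector. -/
lemma functional_Q_le [DecidableEq α] (μ : EuclideanSpace ℝ (Fin n)) (ν : EuclideanSpace ℝ (Fin m))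
    (L : Matrix (Fin n ⊕ α × α) (Fin m ⊕ β × β) ℂ →ₗ[ℝ] ℝ)
    (hL : ∀ x y, L (Matrix.vecMulVec x y) ≤ ‖WithLp.toLp 2 x‖ * ‖WithLp.toLp 2 y‖)
    {φ : EuclideanSpace ℂ (α × β)} (hφ : ‖φ‖ = 1) :
    L (Q μ ν (ketBra φ)) ≤
      √((‖μ‖ ^ 2 + 1) * (‖ν‖ ^ 2 + 1)) + ((Fintype.card α : ℝ) - 1) := by
  obtain ⟨v, w, hv, h, hF, hS, hn⟩ := exists_schmidt_decomposition φ
  rw [hφ, one_pow] at hn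
  have hn' : ∑ i, ((‖w i‖ ^ 2 : ℝ) : ℂ) = 1 := by exact_mod_cast hn.symm
  let c : EuclideanSpace ℂ α → EuclideanSpace ℂ α := fun x => WithLp.toLp 2 (star x.ofLp)
  let c' : EuclideanSpace ℂ β → EuclideanSpace ℂ β := fun x => WithLp.toLp 2 (star x.ofLp)
  -- A unit vector, or zero when `w i = 0`; only `‖e i‖ ≤ 1` is needed later.
  let e : α → EuclideanSpace ℂ β := fun i => ((‖w i‖⁻¹ : ℝ) : ℂ) • w i
  let D : α → Matrix (Fin n ⊕ α × α) (Fin m ⊕ β × β) ℂ := fun i =>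
    Matrix.vecMulVec (extVec μ (v i) (c (v i))) (extVec ν (c' (e i)) (e i))
  -- The zero head reflects that cross terms are absent from both reduced states, by orthogonality
  -- of the Schmidt vectors.
  let O : α → α → Matrix (Fin n ⊕ α × α) (Fin m ⊕ β × β) ℂ := fun i j =>
    Matrix.vecMulVec (extVec 0 (v j) (c (v i))) (extVec 0 (c' (w j)) (w i))
  have he : ∀ i k l, ((‖w i‖ ^ 2 : ℝ) : ℂ) * (star (e i l) * e i k) = w i k * star (w i l) := by
    intro i k l
    by_cases hz : w i = 0
    · simp [hz]
    · have hz' : (‖w i‖ : ℂ) ≠ 0 := by simpa using hz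
      simp only [e, PiLp.smul_apply, smul_eq_mul, star_mul', Complex.star_def, Complex.conj_ofReal]
      push_cast
      field_simp
  have hQ : Q μ ν (ketBra φ) =
      ∑ i, (‖w i‖ ^ 2) • D i + ∑ i, ∑ j, if i = j then 0 else O i j := by
    ext x y
    rcases x with x | x <;> rcases y with y | y
    · simp only [Q, Matrix.fromBlocks_apply₁₁, Matrix.add_apply, Matrix.sum_apply,
        Matrix.smul_apply, Complex.real_smul]
      have hO : ∀ i j, (if i = j then 0 else O i j) (Sum.inl x) (Sum.inl y) = 0 := by
        intro i j
        split_ifs <;> simp [O, extVec, Matrix.vecMulVec_apply]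
      simp only [hO, Finset.sum_const_zero, add_zero]
      simp only [D, extVec, Matrix.vecMulVec_apply, Sum.elim_inl, ← Finset.sum_mul, hn', one_mul]
    · simp only [Q, Matrix.fromBlocks_apply₁₂, Matrix.add_apply, Matrix.sum_apply,
        Matrix.smul_apply, Complex.real_smul]
      have hO : ∀ i j, (if i = j then 0 else O i j) (Sum.inl x) (Sum.inr y) = 0 := by
        intro i j
        split_ifs <;> simp [O, extVec, Matrix.vecMulVec_apply]
      simp only [hO, Finset.sum_const_zero, add_zero]
      simp only [D, extVec, Matrix.vecMulVec_apply, Sum.elim_inl, Sum.elim_inr, Matrix.vec, hF,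
        Finset.mul_sum, c', Pi.star_apply]
      refine Finset.sum_congr rfl fun i _ => ?_
      rw [← he]
      ring
    · simp only [Q, Matrix.fromBlocks_apply₂₁, Matrix.add_apply, Matrix.sum_apply,
        Matrix.smul_apply, Complex.real_smul]
      have hO : ∀ i j, (if i = j then 0 else O i j) (Sum.inr x) (Sum.inl y) = 0 := by
        intro i j
        split_ifs <;> simp [O, extVec, Matrix.vecMulVec_apply]
      simp only [hO, Finset.sum_const_zero, add_zero]
      simp only [D, extVec, Matrix.vecMulVec_apply, Sum.elim_inl, Sum.elim_inr, Matrix.vec, hS,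
        Finset.sum_mul, c, Pi.star_apply]
      exact Finset.sum_congr rfl fun i _ => by ring
    · have hO : ∀ i j, (if i = j then 0 else O i j) (Sum.inr x) (Sum.inr y) =
          O i j (Sum.inr x) (Sum.inr y) -
            if i = j then O i j (Sum.inr x) (Sum.inr y) else 0 := by
        intro i j
        split_ifs <;> simp
      simp only [Q, Matrix.fromBlocks_apply₂₂, Matrix.add_apply, Matrix.sum_apply,
        Matrix.smul_apply, Complex.real_smul, hO, Finset.sum_sub_distrib, Finset.sum_ite_eq,
        Finset.mem_univ, if_true]
      -- On the realigned block the weighted diagonal terms are the missing `O i i`, which completes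
      -- the double sum.
      have hd : ∀ i, ((‖w i‖ ^ 2 : ℝ) : ℂ) * D i (Sum.inr x) (Sum.inr y) =
          O i i (Sum.inr x) (Sum.inr y) := by
        intro i
        simp only [D, O, extVec, Matrix.vecMulVec_apply, Sum.elim_inr, c', c, Pi.star_apply]
        linear_combination (v i x.1 * star (v i x.2)) * he i y.2 y.1
      simp only [hd, add_sub_cancel]
      simp only [realign, block, Matrix.vec, Matrix.of_apply, ketBra, h, star_sum, star_mul',
        star_star, Finset.sum_mul_sum, O, extVec, Matrix.vecMulVec_apply, Sum.elim_inr, c', c,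
        Pi.star_apply]
      exact Finset.sum_congr rfl fun i _ => Finset.sum_congr rfl fun j _ => by ring
  have hD : ∀ i, L (D i) ≤ √((‖μ‖ ^ 2 + 1) * (‖ν‖ ^ 2 + 1)) := by
    intro i
    have he1 : ‖e i‖ ≤ 1 := by
      simp only [e, norm_smul, Complex.norm_real, norm_inv, norm_norm]
      exact inv_mul_le_one
    refine (hL _ _).trans (norm_extVec_mul_le μ ν ?_ ?_)
    · simp only [c, norm_star_coord, hv, mul_one, le_refl]
    · simp only [c', norm_star_coord]
      exact mul_le_one₀ he1 (norm_nonneg _) he1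
  have hO : ∀ i j, L (if i = j then 0 else O i j) ≤
      ‖w i‖ * ‖w j‖ - if i = j then ‖w i‖ * ‖w j‖ else 0 := by
    intro i j
    split_ifs
    · simp
    · rw [sub_zero]
      refine (hL _ _).trans (abs_le_of_sq_le_sq' ?_ (by positivity)).2
      rw [mul_pow, norm_extVec_sq, norm_extVec_sq]
      simp only [c, c', norm_star_coord, hv, norm_zero]
      exact le_of_eq (by ring)
  -- Cauchy–Schwarz over the `card α` Schmidt coefficients; this is where the dimension enters.
  have hcs : (∑ i, ‖w i‖) ^ 2 ≤ Fintype.card α := by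
    have := sq_sum_le_card_mul_sum_sq (s := Finset.univ) (f := fun i => ‖w i‖)
    rwa [← hn, mul_one] at this
  rw [hQ, map_add, map_sum, map_sum]
  refine add_le_add ?_ ?_
  · calc ∑ i, L (‖w i‖ ^ 2 • D i)
        ≤ ∑ i, ‖w i‖ ^ 2 * √((‖μ‖ ^ 2 + 1) * (‖ν‖ ^ 2 + 1)) :=
          Finset.sum_le_sum fun i _ => by
            rw [map_smul, smul_eq_mul]
            exact mul_le_mul_of_nonneg_left (hD i) (by positivity)
      _ = √((‖μ‖ ^ 2 + 1) * (‖ν‖ ^ 2 + 1)) := by rw [← Finset.sum_mul, ← hn, one_mul]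
  · calc ∑ i, L (∑ j, if i = j then 0 else O i j)
        ≤ ∑ i, ∑ j, (‖w i‖ * ‖w j‖ - if i = j then ‖w i‖ * ‖w j‖ else 0) :=
          Finset.sum_le_sum fun i _ => by
            rw [map_sum]
            exact Finset.sum_le_sum fun j _ => hO i j
      _ = (∑ i, ‖w i‖) ^ 2 - ∑ i, ‖w i‖ ^ 2 := by
          simp only [Finset.sum_sub_distrib, Finset.sum_ite_eq, Finset.mem_univ, if_true,
            sq, Finset.sum_mul_sum]
      _ ≤ (Fintype.card α : ℝ) - 1 := by rw [← hn]; exact sub_le_sub_right hcs 1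

/-- The trace norm of `Q_{μ,ν}` of a mixture of pure states, where the excess `e i` is zero
for product vectors. -/
theorem traceNorm_Q_mixture_le [DecidableEq α] [DecidableEq β] {ι : Type*} [Fintype ι]
    (μ : EuclideanSpace ℝ (Fin n)) (ν : EuclideanSpace ℝ (Fin m))
    (p e : ι → ℝ) (φ : ι → EuclideanSpace ℂ (α × β)) (hp : ∀ i, 0 ≤ p i) (hp1 : ∑ i, p i = 1)
    (hφ : ∀ i, ‖φ i‖ = 1)
    (he : ∀ i, (Fintype.card α : ℝ) - 1 = e i ∨ (0 = e i ∧
      ∃ (χ : EuclideanSpace ℂ α) (ψ : EuclideanSpace ℂ β), ∀ a b, φ i (a, b) = χ a * ψ b)) :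
    traceNorm (Q μ ν (∑ i, (p i : ℂ) • ketBra (φ i))) ≤
      √((‖μ‖ ^ 2 + 1) * (‖ν‖ ^ 2 + 1)) + ∑ i, p i * e i := by
  obtain ⟨L, hLQ, hL⟩ := exists_dual_functional (Q μ ν (∑ i, (p i : ℂ) • ketBra (φ i)))
  rw [← hLQ, Q_sum_smul μ ν p hp1, map_sum]
  calc ∑ i, L (p i • Q μ ν (ketBra (φ i)))
      ≤ ∑ i, p i * (√((‖μ‖ ^ 2 + 1) * (‖ν‖ ^ 2 + 1)) + e i) :=
        Finset.sum_le_sum fun i _ => by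
          rw [map_smul, smul_eq_mul]
          refine mul_le_mul_of_nonneg_left ?_ (hp i)
          rcases he i with h | ⟨h, χ, ψ, hprod⟩
          · rw [← h]
            exact functional_Q_le μ ν L hL (hφ i)
          · rw [← h, add_zero]
            exact functional_Q_product_le μ ν L hL (hφ i) hprod
    _ = _ := by simp only [mul_add, Finset.sum_add_distrib, ← Finset.sum_mul, hp1, one_mul]

end Bipartite

/-! ### The three cuts of a biseparable state. -/

section Tripartite

variable {α β γ : Type*}

/-- A vector of the system `1 2 3`, viewed in the bipartition `2|13`. -/
def vecCut2 (φ : EuclideanSpace ℂ (α × β × γ)) : EuclideanSpace ℂ (β × α × γ) :=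
  WithLp.toLp 2 fun x => φ (x.2.1, x.1, x.2.2)

/-- A vector of the system `1 2 3`, viewed in the bipartition `3|12`. -/
def vecCut3 (φ : EuclideanSpace ℂ (α × β × γ)) : EuclideanSpace ℂ (γ × α × β) :=
  WithLp.toLp 2 fun x => φ (x.2.1, x.2.2, x.1)

lemma cut2_mixture {ι : Type*} [Fintype ι] (p : ι → ℝ) (φ : ι → EuclideanSpace ℂ (α × β × γ)) :
    cut2 (∑ i, (p i : ℂ) • ketBra (φ i)) = ∑ i, (p i : ℂ) • ketBra (vecCut2 (φ i)) := by
  ext x y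
  simp [cut2, ketBra, vecCut2, Matrix.sum_apply]

lemma cut3_mixture {ι : Type*} [Fintype ι] (p : ι → ℝ) (φ : ι → EuclideanSpace ℂ (α × β × γ)) :
    cut3 (∑ i, (p i : ℂ) • ketBra (φ i)) = ∑ i, (p i : ℂ) • ketBra (vecCut3 (φ i)) := by
  ext x y
  simp [cut3, ketBra, vecCut3, Matrix.sum_apply]

variable [Fintype α] [Fintype β] [Fintype γ]

lemma norm_vecCut2 (φ : EuclideanSpace ℂ (α × β × γ)) : ‖vecCut2 φ‖ = ‖φ‖ := by
  simp only [EuclideanSpace.norm_eq, vecCut2, Fintype.sum_prod_type]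
  rw [Finset.sum_comm]

lemma norm_vecCut3 (φ : EuclideanSpace ℂ (α × β × γ)) : ‖vecCut3 φ‖ = ‖φ‖ := by
  simp only [EuclideanSpace.norm_eq, vecCut3, Fintype.sum_prod_type]
  rw [Finset.sum_comm]
  simp only [Finset.sum_comm (γ := γ)]

/-- A single index set lets the same decomposition be fed to all three cuts, while the summand of an
index still records the cut in which its vector factors. -/
lemma IsBiseparable.exists_mixture {ρ : Matrix (α × β × γ) (α × β × γ) ℂ} (h : IsBiseparable ρ) :
    ∃ (a b c : ℕ) (p : Fin a ⊕ Fin b ⊕ Fin c → ℝ)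
      (φ : Fin a ⊕ Fin b ⊕ Fin c → EuclideanSpace ℂ (α × β × γ)),
      (∀ i, 0 ≤ p i) ∧ ∑ i, p i = 1 ∧ (∀ i, ‖φ i‖ = 1) ∧ (∀ i, IsProduct1 (φ (.inl i))) ∧
      (∀ i, IsProduct2 (φ (.inr (.inl i)))) ∧ (∀ i, IsProduct3 (φ (.inr (.inr i)))) ∧
      ρ = ∑ i, (p i : ℂ) • ketBra (φ i) := by
  obtain ⟨a, b, c, p, q, r, φ, ψ, ω, hp, hq, hr, hsum, rfl⟩ := h
  refine ⟨a, b, c, Sum.elim p (Sum.elim q r), Sum.elim φ (Sum.elim ψ ω), ?_, ?_, ?_,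
    fun i => (hp i).2.2, fun i => (hq i).2.2, fun i => (hr i).2.2, ?_⟩
  · rintro (i | i | i)
    exacts [(hp i).1, (hq i).1, (hr i).1]
  · simpa [Fintype.sum_sum_type, add_assoc] using hsum
  · rintro (i | i | i)
    exacts [(hp i).2.1, (hq i).2.1, (hr i).2.1]
  · simp [Fintype.sum_sum_type, add_assoc]

/-- The bound of `avgQ` on biseparable states of three systems of equal dimension. -/
theorem IsBiseparable.avgQ_le [DecidableEq α] [DecidableEq β] [DecidableEq γ] {n m d : ℕ}
    (hα : Fintype.card α = d) (hβ : Fintype.card β = d) (hγ : Fintype.card γ = d)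
    (μ : EuclideanSpace ℝ (Fin n)) (ν : EuclideanSpace ℝ (Fin m))
    {ρ : Matrix (α × β × γ) (α × β × γ) ℂ} (h : IsBiseparable ρ) :
    avgQ μ ν ρ ≤ √((‖μ‖ ^ 2 + 1) * (‖ν‖ ^ 2 + 1)) + 2 * ((d : ℝ) - 1) / 3 := by
  obtain ⟨a, b, c, p, φ, hp, hp1, hφ, h1, h2, h3, rfl⟩ := h.exists_mixture
  let D : ℝ := d - 1
  -- The excess is zero on the group that factors in the cut at hand and `D` on the other two.
  have b1 := traceNorm_Q_mixture_le μ ν p (Sum.elim (fun _ => 0) fun _ => D) φ hp hp1 hφ (by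
    rintro (i | i)
    · obtain ⟨χ, ψ, hi⟩ := h1 i
      exact .inr ⟨rfl, χ, ψ, fun x y => hi x y.1 y.2⟩
    · exact .inl (by rw [hα]; rfl))
  have b2 := traceNorm_Q_mixture_le μ ν p
    (Sum.elim (fun _ => D) (Sum.elim (fun _ => 0) fun _ => D)) (fun i => vecCut2 (φ i)) hp hp1
    (fun i => (norm_vecCut2 _).trans (hφ i)) (by
      rintro (i | i | i)
      · exact .inl (by rw [hβ]; rfl)
      · obtain ⟨χ, ψ, hi⟩ := h2 i
        exact .inr ⟨rfl, χ, ψ, fun x y => hi y.1 x y.2⟩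
      · exact .inl (by rw [hβ]; rfl))
  have b3 := traceNorm_Q_mixture_le μ ν p
    (Sum.elim (fun _ => D) (Sum.elim (fun _ => D) fun _ => 0)) (fun i => vecCut3 (φ i)) hp hp1
    (fun i => (norm_vecCut3 _).trans (hφ i)) (by
      rintro (i | i | i)
      · exact .inl (by rw [hγ]; rfl)
      · exact .inl (by rw [hγ]; rfl)
      · obtain ⟨χ, ψ, hi⟩ := h3 i
        exact .inr ⟨rfl, χ, ψ, fun x y => hi y.1 y.2 x⟩)
  rw [← cut2_mixture] at b2
  rw [← cut3_mixture] at b3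
  simp only [Fintype.sum_sum_type, Sum.elim_inl, Sum.elim_inr, mul_zero, Finset.sum_const_zero,
    ← Finset.sum_mul] at b1 b2 b3 hp1
  rw [avgQ, cut1]
  change _ ≤ √((‖μ‖ ^ 2 + 1) * (‖ν‖ ^ 2 + 1)) + 2 * D / 3
  -- Adding the three bounds counts each group's weight twice, so the total excess is `2 * D`.
  have hD : (∑ i, p (.inl i) + (∑ i, p (.inr (.inl i)) + ∑ i, p (.inr (.inr i)))) * D = D := by
    rw [hp1, one_mul]
  simp only [Fintype.sum_sum_type] at b1 b2 b3 ⊢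
  linarith

end Tripartite

end Tripartite

theorem theorem4 (d n m : ℕ)
    (μ : EuclideanSpace ℝ (Fin n)) (ν : EuclideanSpace ℝ (Fin m))
    (ρ : Matrix (Fin d × Fin d × Fin d) (Fin d × Fin d × Fin d) ℂ)
    (hρ : Tripartite.IsState ρ) :
    (Tripartite.IsBiseparable ρ →
      Tripartite.avgQ μ ν ρ
        ≤ Real.sqrt ((‖μ‖ ^ 2 + 1) * (‖ν‖ ^ 2 + 1)) + 2 * ((d : ℝ) - 1) / 3) ∧
    (Real.sqrt ((‖μ‖ ^ 2 + 1) * (‖ν‖ ^ 2 + 1)) + 2 * ((d : ℝ) - 1) / 3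
        < Tripartite.avgQ μ ν ρ →
      Tripartite.IsGenuinelyEntangled ρ) := by
  have hd : Fintype.card (Fin d) = d := Fintype.card_fin d
  exact ⟨fun h => h.avgQ_le hd hd hd μ ν,
    fun h => ⟨hρ, fun hb => (hb.avgQ_le hd hd hd μ ν).not_gt h⟩⟩
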